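/- There exist absolute constants $c>0$ and $C\ge 1$ such that the following holds for all integers $n\ge 1$ and $R$ with $R>Cn$. Consider the lattice $\mathbb{Z}^n$ as a graph, two points being adjacent when their $\ell^1$-distance is $1$, and let $\Gamma$ be a group of automorphisms of this graph that contains all translations (for example, the full automorphism group or the group of translations). Let $X=(X_v)_{v\in\mathbb{Z}^n}$ be a $\Gamma$-factor-of-IID process with values in $\{0,1\}$ and radius $R$; that is, $X=F(Z)$ almost surely, where $Z=(Z_v)_{v\in\mathbb{Z}^n}$ are independent random variables, uniformly distributed on $[0,1]$, and $F\colon[0,1]^{\mathbb{Z}^n}\to\{0,1\}^{\mathbb{Z}^n}$ is a measurable $\Gamma$-equivariant map such that, for every $v$, the coordinate $F(z)_v$ depends only on the values $z_u$ with $u$ at graph distance at most $R$ from $v$. If $X$ almost surely defines an independent set, i.e. the values $X_u$ and $X_v$ of two neighbouring vertices are almost surely not both $1$, then the density of this independent set satisfies, for every vertex $v$, $$\mathbb{P}(X_v=1)\;\le\;\frac12-\frac{cn}{R\log(R/n)} .$$ -/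

import Mathlib

open MeasureTheory ProbabilityTheory

/-- The integer lattice `ℤ^n` as a graph (the standard Cayley graph of the group `ℤ^n`):
two points are adjacent when their `ℓ¹`-distance is `1`. -/
def latticeGraph (n : ℕ) : SimpleGraph (Fin n → ℤ) where
  Adj u v := ∑ i, |u i - v i| = 1
  symm := ⟨fun u v h => by simpa only [abs_sub_comm] using h⟩
  loopless := ⟨fun u h => by simp at h⟩

/-- The translation `v ↦ t + v`, as an automorphism of the lattice graph. -/
def latticeTranslation {n : ℕ} (t : Fin n → ℤ) : latticeGraph n ≃g latticeGraph n where
  toEquiv := Equiv.addLeft t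
  map_rel_iff' := by
    intro u v
    simp [latticeGraph]

/-- `X` is a `Γ`-factor-of-IID process of radius `R` on the graph `G`: there are independent
uniform `[0, 1]` seeds `Z v`, one for each vertex, and a measurable `Γ`-equivariant map `F`
such that `X = F(Z)` almost surely, and the value of `F` at `v` depends only on the
coordinates in the ball of radius `R` around `v` in the graph distance. -/
def IsFactorOfIID {V : Type*} (G : SimpleGraph V) (Γ : Subgroup (G ≃g G)) (R : ℕ)
    {M : Type*} [MeasurableSpace M] {Ω : Type*} [MeasurableSpace Ω] (P : Measure Ω)
    (X : V → Ω → M) : Prop :=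
  ∃ (Z : V → Ω → unitInterval) (F : (V → unitInterval) → (V → M)),
    (∀ v, Measurable (Z v)) ∧
    iIndepFun Z P ∧
    (∀ v, P.map (Z v) = volume) ∧
    Measurable F ∧
    (∀ g ∈ Γ, ∀ z : V → unitInterval, F (fun v => z (g v)) = fun v => F z (g v)) ∧
    (∀ v, ∀ z z' : V → unitInterval,
      (∀ u, G.edist v u ≤ R → z u = z' u) → F z v = F z' v) ∧
    (∀ v, ∀ᵐ ω ∂P, X v ω = F (fun u => Z u ω) v)

/-- The `0`-`1` valued process `X` almost surely defines an independent set of `G`: the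
values at two neighbouring vertices are never both `1`. -/
def DefinesIndepSet {V : Type*} (G : SimpleGraph V) {Ω : Type*} [MeasurableSpace Ω]
    (P : Measure Ω) (X : V → Ω → Fin 2) : Prop :=
  ∀ u v, G.Adj u v → ∀ᵐ ω ∂P, ¬ (X u ω = 1 ∧ X v ω = 1)

/-! Let `f v` be the indicator of `X v = 1`, with mean `p`, variance `V = p - p ^ 2` and defect `δ =
1 - 2 * p`. The covariance of `f 0` and `f (L e_i)` is bounded from both sides.

Lower bound: neighbouring values sum to 1 except with probability `δ`, so over an even shift `L = 2
* m` the values differ with probability at most `2 * m * δ`, and the covariance is at least `V - m *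
δ` (`integral_abs_sub_even_shift_le`).

Upper bound: reveal the seeds in lexicographic order, which translations preserve. The covariance
becomes a sum over seeds of products of martingale increments. Let `σ x ≥ 0` be the share of seed
`x` in `V`; the share of seed `u` in the variance of `f w` is `σ (u - w)`. Cauchy-Schwarz with equal
weights gives only `V`; weights `L + |x i|` give half of `∑ x, σ x * (1 + 2 * |x i| / L)`
(`two_mul_cov_le`). Since `σ` lives on the `ℓ¹`-ball of radius `R`, summing over the `n` directions
costs `R` only once, and the average covariance is at most `(1 / 2 + R / (n * L)) * V`
(`two_mul_sum_cov_le`).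

For `n * m ≥ 2 * R` the two bounds give `V ≤ 4 * m * δ` (`density_sub_sq_le`). Taking `m` of order
`R / n` gives `1 / 2 - p ≥ c * n / R`, which is stronger than the claim because `log (R / n) ≥ 1`.
-/

/-! ### Resampling the coordinates outside a set. -/

section Splice

variable {ι E : Type*}

open Classical in
/-- The configuration that agrees with `z` on `S` and with `z'` off `S`. -/
noncomputable def splice (S : Set ι) (z z' : ι → E) : ι → E := S.piecewise z z'

lemma splice_of_mem {S : Set ι} {i : ι} (h : i ∈ S) (z z' : ι → E) : splice S z z' i = z i := by
  simp [splice, h]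

lemma splice_of_notMem {S : Set ι} {i : ι} (h : i ∉ S) (z z' : ι → E) :
    splice S z z' i = z' i := by
  simp [splice, h]

lemma splice_splice_inter (S T : Set ι) (z z' z'' : ι → E) :
    splice T (splice S z z') z'' = splice (S ∩ T) z (splice T z' z'') := by
  ext i
  by_cases h : i ∈ S <;> by_cases h' : i ∈ T <;> simp [splice, h, h']

variable [MeasurableSpace E]

lemma measurable_splice (S : Set ι) :
    Measurable fun p : (ι → E) × (ι → E) => splice S p.1 p.2 := by
  refine measurable_pi_lambda _ fun i => ?_
  by_cases h : i ∈ S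
  · simp only [splice_of_mem h]
    fun_prop
  · simp only [splice_of_notMem h]
    fun_prop

lemma measurable_splice_right (S : Set ι) (z : ι → E) : Measurable fun z' => splice S z z' :=
  (measurable_splice S).comp measurable_prodMk_left

/-- The law of a family of independent random variables with common law `ν`. -/
noncomputable abbrev iidMeasure (ι : Type*) {E : Type*} [MeasurableSpace E] (ν : Measure E)
    [IsProbabilityMeasure ν] : Measure (ι → E) :=
  Measure.infinitePi fun _ : ι => ν

variable (ν : Measure E) [IsProbabilityMeasure ν]

lemma measurePreserving_splice (S : Set ι) :
    MeasurePreserving (fun p : (ι → E) × (ι → E) => splice S p.1 p.2)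
      ((iidMeasure ι ν).prod (iidMeasure ι ν)) (iidMeasure ι ν) := by
  classical
  refine ⟨measurable_splice S, Measure.eq_infinitePi _ fun s t ht => ?_⟩
  have hpre : (fun p : (ι → E) × (ι → E) => splice S p.1 p.2) ⁻¹' (Set.pi s t) =
      (Set.pi (s.filter (· ∈ S)) t) ×ˢ (Set.pi (s.filter (· ∉ S)) t) := by
    ext p
    simp only [Set.mem_preimage, Set.mem_pi, Set.mem_prod, Finset.coe_filter, Set.mem_ofPred_eq,
      Finset.mem_coe]
    constructor
    · intro h
      refine ⟨fun i hi => ?_, fun i hi => ?_⟩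
      · simpa only [splice_of_mem hi.2] using h i hi.1
      · simpa only [splice_of_notMem hi.2] using h i hi.1
    · rintro ⟨h1, h2⟩ i hi
      by_cases h : i ∈ S
      · simpa only [splice_of_mem h] using h1 i ⟨hi, h⟩
      · simpa only [splice_of_notMem h] using h2 i ⟨hi, h⟩
  rw [Measure.map_apply (measurable_splice S)
    (MeasurableSet.pi s.countable_toSet fun i _ => ht i), hpre, Measure.prod_prod,
    Measure.infinitePi_pi _ (fun i _ => ht i), Measure.infinitePi_pi _ (fun i _ => ht i),
    Finset.prod_filter_mul_prod_filter_not]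

end Splice

/-! ### Calculus of bounded measurable functions. -/

/-- A bounded measurable real function. -/
structure IsBddMeasurable {α : Type*} [MeasurableSpace α] (f : α → ℝ) : Prop where
  measurable : Measurable f
  bounded : ∃ C, ∀ z, |f z| ≤ C

namespace IsBddMeasurable

variable {α β : Type*} [MeasurableSpace α] [MeasurableSpace β] {f g : α → ℝ}

lemma comp (hf : IsBddMeasurable f) {φ : β → α} (hφ : Measurable φ) :
    IsBddMeasurable fun x => f (φ x) :=
  ⟨hf.measurable.comp hφ, hf.bounded.imp fun _ h x => h (φ x)⟩

lemma sub (hf : IsBddMeasurable f) (hg : IsBddMeasurable g) :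
    IsBddMeasurable fun x => f x - g x := by
  obtain ⟨C, hC⟩ := hf.bounded
  obtain ⟨D, hD⟩ := hg.bounded
  exact ⟨hf.measurable.sub hg.measurable, C + D, fun x =>
    (abs_sub _ _).trans (add_le_add (hC x) (hD x))⟩

lemma add (hf : IsBddMeasurable f) (hg : IsBddMeasurable g) :
    IsBddMeasurable fun x => f x + g x := by
  obtain ⟨C, hC⟩ := hf.bounded
  obtain ⟨D, hD⟩ := hg.bounded
  exact ⟨hf.measurable.add hg.measurable, C + D, fun x =>
    (abs_add_le _ _).trans (add_le_add (hC x) (hD x))⟩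

lemma abs (hf : IsBddMeasurable f) : IsBddMeasurable fun x => |f x| :=
  ⟨continuous_abs.measurable.comp hf.measurable, hf.bounded.imp fun C h x => by simpa using h x⟩

lemma const (c : ℝ) : IsBddMeasurable fun _ : α => c :=
  ⟨measurable_const, |c|, fun _ => le_rfl⟩

lemma mul (hf : IsBddMeasurable f) (hg : IsBddMeasurable g) :
    IsBddMeasurable fun x => f x * g x := by
  obtain ⟨C, hC⟩ := hf.bounded
  obtain ⟨D, hD⟩ := hg.bounded
  exact ⟨hf.measurable.mul hg.measurable, C * D, fun x => by
    rw [abs_mul]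
    exact mul_le_mul (hC x) (hD x) (abs_nonneg _) ((abs_nonneg _).trans (hC x))⟩

lemma const_mul (c : ℝ) (hf : IsBddMeasurable f) : IsBddMeasurable fun x => c * f x :=
  (const c).mul hf

lemma integrable (hf : IsBddMeasurable f) (μ : Measure α) [IsFiniteMeasure μ] :
    Integrable f μ := by
  obtain ⟨C, hC⟩ := hf.bounded
  exact Integrable.of_bound hf.measurable.aestronglyMeasurable C (Filter.Eventually.of_forall hC)

lemma integral_add (hf : IsBddMeasurable f) (hg : IsBddMeasurable g) (μ : Measure α)
    [IsFiniteMeasure μ] : ∫ x, f x + g x ∂μ = ∫ x, f x ∂μ + ∫ x, g x ∂μ :=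
  MeasureTheory.integral_add (hf.integrable μ) (hg.integrable μ)

lemma integral_sub (hf : IsBddMeasurable f) (hg : IsBddMeasurable g) (μ : Measure α)
    [IsFiniteMeasure μ] : ∫ x, f x - g x ∂μ = ∫ x, f x ∂μ - ∫ x, g x ∂μ :=
  MeasureTheory.integral_sub (hf.integrable μ) (hg.integrable μ)

lemma sq_integral_le (hf : IsBddMeasurable f) (μ : Measure α) [IsProbabilityMeasure μ] :
    (∫ x, f x ∂μ) ^ 2 ≤ ∫ x, f x * f x ∂μ := by
  set c := ∫ x, f x ∂μ with hc
  have h0 : 0 ≤ ∫ x, (f x - c) * (f x - c) ∂μ := integral_nonneg fun x => mul_self_nonneg _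
  have h1 : ∫ x, (f x - c) * (f x - c) ∂μ = (∫ x, f x * f x ∂μ) - 2 * c * c + c * c := by
    have : ∀ x, (f x - c) * (f x - c) = f x * f x - (2 * c) * f x + c * c := fun x => by ring
    simp only [this]
    rw [((hf.mul hf).sub (hf.const_mul _)).integral_add (const _),
      (hf.mul hf).integral_sub (hf.const_mul _),
      integral_const_mul, ← hc]
    simp
  nlinarith

end IsBddMeasurable

/-! ### Conditional expectations on a product space and their correlations. -/

section Average

variable {ι E : Type*} [MeasurableSpace E] (ν : Measure E) [IsProbabilityMeasure ν]

/-- The conditional expectation of `f` given the coordinates in `S`. -/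
noncomputable def averageOff (S : Set ι) (f : (ι → E) → ℝ) (z : ι → E) : ℝ :=
  ∫ z', f (splice S z z') ∂iidMeasure ι ν

variable {f g : (ι → E) → ℝ}

lemma IsBddMeasurable.averageOff (hf : IsBddMeasurable f) (S : Set ι) :
    IsBddMeasurable (averageOff ν S f) := by
  refine ⟨?_, ?_⟩
  · have : StronglyMeasurable fun p : (ι → E) × (ι → E) => f (splice S p.1 p.2) :=
      (hf.measurable.comp (measurable_splice S)).stronglyMeasurable
    exact this.integral_prod_right.measurable
  · obtain ⟨C, hC⟩ := hf.bounded
    refine ⟨C, fun z => ?_⟩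
    have := norm_integral_le_of_norm_le_const (μ := iidMeasure ι ν)
      (f := fun z' => f (splice S z z')) (C := C) (Filter.Eventually.of_forall fun z' => hC _)
    simpa [_root_.averageOff] using this

lemma integral_averageOff (hf : IsBddMeasurable f) (S : Set ι) :
    ∫ z, averageOff ν S f z ∂iidMeasure ι ν = ∫ z, f z ∂iidMeasure ι ν := by
  have h := measurePreserving_splice (ι := ι) ν S
  rw [← h.map_eq, integral_map h.measurable.aemeasurable
    hf.measurable.aestronglyMeasurable, integral_prod _
    ((hf.comp (measurable_splice S)).integrable _), h.map_eq]
  rfl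

/-- Independence makes conditional expectations on coordinate sets commute. Being defined by
explicit integrals, they satisfy this identity at every point, not just almost everywhere. -/
lemma averageOff_averageOff (hf : IsBddMeasurable f) (S T : Set ι) :
    averageOff ν S (averageOff ν T f) = averageOff ν (S ∩ T) f := by
  funext z
  have h := measurePreserving_splice (ι := ι) ν T
  have hb : IsBddMeasurable fun z' => f (splice (S ∩ T) z z') :=
    hf.comp (measurable_splice_right _ z)
  have := integral_averageOff ν hb T
  simp only [averageOff] at this ⊢
  simp only [splice_splice_inter, this]

lemma averageOff_inter_of_dependsOn {A : Set ι} (hA : DependsOn f A) (S : Set ι) :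
    averageOff ν (S ∩ A) f = averageOff ν S f := by
  funext z
  refine integral_congr_ae (Filter.Eventually.of_forall fun z' => hA fun i hi => ?_)
  by_cases h : i ∈ S <;> simp [splice, h, hi]

lemma averageOff_of_dependsOn {A : Set ι} (hA : DependsOn f A) : averageOff ν A f = f := by
  funext z
  have : ∀ z', f (splice A z z') = f z := fun z' => hA fun i hi => splice_of_mem hi z z'
  simp [averageOff, this]

lemma averageOff_empty (z : ι → E) :
    averageOff ν ∅ f z = ∫ z', f z' ∂iidMeasure ι ν := by
  simp [averageOff, splice]

lemma averageOff_sub (hf : IsBddMeasurable f) (hg : IsBddMeasurable g) (S : Set ι) (z : ι → E) :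
    averageOff ν S (fun x => f x - g x) z = averageOff ν S f z - averageOff ν S g z :=
  integral_sub ((hf.comp (measurable_splice_right S z)).integrable _)
    ((hg.comp (measurable_splice_right S z)).integrable _)

lemma averageOff_const_mul (c : ℝ) (S : Set ι) (z : ι → E) :
    averageOff ν S (fun x => c * f x) z = c * averageOff ν S f z :=
  integral_const_mul _ _

lemma sq_averageOff_le (hf : IsBddMeasurable f) (S : Set ι) (z : ι → E) :
    averageOff ν S f z * averageOff ν S f z ≤ averageOff ν S (fun x => f x * f x) z := by
  have := (hf.comp (measurable_splice_right S z)).sq_integral_le (iidMeasure ι ν)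
  rw [sq] at this
  exact this

/-- The correlation between the conditional expectations of `f` and `g` given the coordinates
in `S`. -/
noncomputable def condCorr (S : Set ι) (f g : (ι → E) → ℝ) : ℝ :=
  ∫ z, averageOff ν S f z * averageOff ν S g z ∂iidMeasure ι ν

lemma condCorr_sub_smul_self (hf : IsBddMeasurable f) (hg : IsBddMeasurable g) (c : ℝ)
    (S : Set ι) :
    condCorr ν S (fun x => c * f x - g x) (fun x => c * f x - g x) =
      c ^ 2 * condCorr ν S f f - 2 * c * condCorr ν S f g + condCorr ν S g g := by
  have hf' := hf.averageOff ν S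
  have hg' := hg.averageOff ν S
  have : ∀ z, averageOff ν S (fun x => c * f x - g x) z *
      averageOff ν S (fun x => c * f x - g x) z =
      c ^ 2 * (averageOff ν S f z * averageOff ν S f z) -
        2 * c * (averageOff ν S f z * averageOff ν S g z) +
        averageOff ν S g z * averageOff ν S g z := fun z => by
    rw [averageOff_sub ν (hf.const_mul c) hg, averageOff_const_mul]
    ring
  simp only [condCorr, this]
  rw [(((hf'.mul hf').const_mul _).sub ((hf'.mul hg').const_mul _)).integral_add (hg'.mul hg'),
    ((hf'.mul hf').const_mul _).integral_sub ((hf'.mul hg').const_mul _), integral_const_mul, integral_const_mul]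

/-- Tower property followed by conditional Jensen for the square. -/
lemma condCorr_self_mono (hf : IsBddMeasurable f) {S T : Set ι} (hST : S ⊆ T) :
    condCorr ν S f f ≤ condCorr ν T f f := by
  have hT := hf.averageOff ν T
  have h : averageOff ν S f = averageOff ν S (averageOff ν T f) := by
    rw [averageOff_averageOff ν hf, Set.inter_eq_left.2 hST]
  have hS := hT.averageOff ν S
  rw [condCorr, condCorr, h, ← integral_averageOff ν (hT.mul hT) S]
  exact integral_mono ((hS.mul hS).integrable _) (((hT.mul hT).averageOff ν S).integrable _)
    fun z => sq_averageOff_le ν hT S z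

lemma condCorr_inter_of_dependsOn {A : Set ι} (hf : DependsOn f A) (hg : DependsOn g A)
    (S : Set ι) : condCorr ν (S ∩ A) f g = condCorr ν S f g := by
  simp only [condCorr, averageOff_inter_of_dependsOn ν hf, averageOff_inter_of_dependsOn ν hg]

lemma condCorr_of_dependsOn {A : Set ι} (hf : DependsOn f A) (hg : DependsOn g A) :
    condCorr ν A f g = ∫ z, f z * g z ∂iidMeasure ι ν := by
  simp only [condCorr, averageOff_of_dependsOn ν hf, averageOff_of_dependsOn ν hg]

lemma condCorr_empty :
    condCorr ν ∅ f g = (∫ z, f z ∂iidMeasure ι ν) * ∫ z, g z ∂iidMeasure ι ν := by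
  simp [condCorr, averageOff_empty]

lemma measurePreserving_reindex (e : ι ≃ ι) :
    MeasurePreserving (fun (z : ι → E) i => z (e i)) (iidMeasure ι ν) (iidMeasure ι ν) :=
  ⟨by fun_prop, Measure.map_infinitePi_infinitePi_of_inj (e.injective)⟩

lemma averageOff_reindex (hf : IsBddMeasurable f) (e : ι ≃ ι) (S : Set ι) (z : ι → E) :
    averageOff ν S (fun z => f fun i => z (e i)) z =
      averageOff ν (e ⁻¹' S) f fun i => z (e i) := by
  have h := measurePreserving_reindex (E := E) ν e
  have hs : ∀ z', (fun i => splice S z z' (e i)) =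
      splice (e ⁻¹' S) (fun i => z (e i)) (fun i => z' (e i)) := fun z' => by
    ext i
    by_cases h : e i ∈ S <;> simp [splice, h]
  simp only [averageOff, hs]
  conv_rhs => rw [← h.map_eq]
  rw [integral_map h.measurable.aemeasurable
    (hf.comp (measurable_splice_right _ _)).measurable.aestronglyMeasurable]

lemma condCorr_reindex (hf : IsBddMeasurable f) (hg : IsBddMeasurable g) (e : ι ≃ ι)
    (S : Set ι) :
    condCorr ν S (fun z => f fun i => z (e i)) (fun z => g fun i => z (e i)) =
      condCorr ν (e ⁻¹' S) f g := by
  have h := measurePreserving_reindex (E := E) ν e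
  simp only [condCorr, averageOff_reindex ν hf, averageOff_reindex ν hg]
  conv_rhs => rw [← h.map_eq]
  rw [integral_map h.measurable.aemeasurable
    ((hf.averageOff ν _).mul (hg.averageOff ν _)).measurable.aestronglyMeasurable]

end Average

/-! ### Martingale decomposition of the covariance. -/

section Increments

variable {ι E K : Type*} [LinearOrder K] [MeasurableSpace E] (ν : Measure E)
  [IsProbabilityMeasure ν] (k : ι → K)

/-- The contribution of the coordinate `u` to the covariance of `f` and `g`, when the coordinates
are revealed in the order given by the key `k`. -/
noncomputable def corrIncrement (u : ι) (f g : (ι → E) → ℝ) : ℝ :=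
  condCorr ν {w | k w ≤ k u} f g - condCorr ν {w | k w < k u} f g

variable {f g : (ι → E) → ℝ}

lemma corrIncrement_self_nonneg (hf : IsBddMeasurable f) (u : ι) :
    0 ≤ corrIncrement ν k u f f :=
  sub_nonneg.2 (condCorr_self_mono ν hf fun _ h => le_of_lt h)

/-- The increment is a positive semidefinite quadratic form; evaluate it at `c * f - g` and divide
by `c`. -/
lemma two_mul_corrIncrement_le (hf : IsBddMeasurable f) (hg : IsBddMeasurable g) {c : ℝ}
    (hc : 0 < c) (u : ι) :
    2 * corrIncrement ν k u f g ≤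
      c * corrIncrement ν k u f f + c⁻¹ * corrIncrement ν k u g g := by
  have h := corrIncrement_self_nonneg ν k ((hf.const_mul c).sub hg) u
  rw [corrIncrement, condCorr_sub_smul_self ν hf hg, condCorr_sub_smul_self ν hf hg] at h
  have h' : 0 ≤ c * (c * corrIncrement ν k u f f + c⁻¹ * corrIncrement ν k u g g -
      2 * corrIncrement ν k u f g) := by
    have e : c * (c⁻¹ * corrIncrement ν k u g g) = corrIncrement ν k u g g := by
      field_simp
    rw [mul_sub, mul_add, e]
    unfold corrIncrement
    linarith
  linarith [nonneg_of_mul_nonneg_right h' hc]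

lemma corrIncrement_self_eq_zero (hk : Function.Injective k) {A : Set ι} (hA : DependsOn f A)
    {u : ι} (hu : u ∉ A) : corrIncrement ν k u f f = 0 := by
  have : {w | k w ≤ k u} ∩ A = {w | k w < k u} ∩ A := by
    ext w
    simp only [Set.mem_inter_iff, Set.mem_ofPred_eq, and_congr_left_iff]
    exact fun hw => ⟨fun h => lt_of_le_of_ne h fun e => hu (hk e ▸ hw), le_of_lt⟩
  rw [corrIncrement, ← condCorr_inter_of_dependsOn ν hA hA, this,
    condCorr_inter_of_dependsOn ν hA hA, sub_self]

/-- Telescoping along the elements of `A` in increasing key order. Intersecting with the finite `A`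
allows orders that are not well-founded, such as the lexicographic order on `ℤ^n`. -/
lemma sum_initialSegment_sub (hk : Function.Injective k) (Ψ : Set ι → ℝ) (A : Finset ι) :
    ∑ u ∈ A, (Ψ ({w | k w ≤ k u} ∩ A) - Ψ ({w | k w < k u} ∩ A)) = Ψ A - Ψ ∅ := by
  classical
  induction A using Finset.induction_on_max_value k with
  | empty => simp
  | insert a s ha hmax ih =>
    have hlt : ∀ x ∈ s, k x < k a := fun x hx =>
      lt_of_le_of_ne (hmax x hx) fun e => ha (hk e ▸ hx)
    have h1 : {w | k w ≤ k a} ∩ (insert a s : Finset ι) = (insert a s : Finset ι) := by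
      ext w
      simp only [Set.mem_inter_iff, Set.mem_ofPred_eq, Finset.coe_insert, Set.mem_insert_iff,
        Finset.mem_coe, and_iff_right_iff_imp]
      rintro (rfl | h)
      · exact le_rfl
      · exact hmax w h
    have h2 : {w | k w < k a} ∩ (insert a s : Finset ι) = (s : Set ι) := by
      ext w
      simp only [Set.mem_inter_iff, Set.mem_ofPred_eq, Finset.coe_insert, Set.mem_insert_iff,
        Finset.mem_coe]
      constructor
      · rintro ⟨h, rfl | h'⟩
        · exact absurd h (lt_irrefl _)
        · exact h'
      · exact fun h => ⟨hlt w h, Or.inr h⟩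
    have h3 : ∀ u ∈ s, Ψ ({w | k w ≤ k u} ∩ (insert a s : Finset ι)) -
        Ψ ({w | k w < k u} ∩ (insert a s : Finset ι)) =
        Ψ ({w | k w ≤ k u} ∩ s) - Ψ ({w | k w < k u} ∩ s) := fun u hu => by
      have := hlt u hu
      rw [Finset.coe_insert, Set.inter_insert_of_notMem, Set.inter_insert_of_notMem]
      · simpa using this.le
      · simpa using this
    rw [Finset.sum_insert ha, h1, h2, Finset.sum_congr rfl h3, ih]
    ring

lemma sum_corrIncrement (hk : Function.Injective k) {A : Finset ι} (hf : DependsOn f (A : Set ι))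
    (hg : DependsOn g (A : Set ι)) :
    ∑ u ∈ A, corrIncrement ν k u f g =
      ∫ z, f z * g z ∂iidMeasure ι ν -
        (∫ z, f z ∂iidMeasure ι ν) * ∫ z, g z ∂iidMeasure ι ν := by
  have h := sum_initialSegment_sub k hk (fun S => condCorr ν S f g) A
  simp only [condCorr_inter_of_dependsOn ν hf hg, condCorr_of_dependsOn ν hf hg,
    condCorr_empty] at h
  exact h

lemma corrIncrement_reindex (hf : IsBddMeasurable f) (hg : IsBddMeasurable g) {e : ι ≃ ι}
    (he : ∀ x y, k (e x) ≤ k (e y) ↔ k x ≤ k y) (u : ι) :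
    corrIncrement ν k (e u) (fun z => f fun i => z (e i)) (fun z => g fun i => z (e i)) =
      corrIncrement ν k u f g := by
  have hle : e ⁻¹' {w | k w ≤ k (e u)} = {w | k w ≤ k u} := Set.ext fun x => he x u
  have hlt : e ⁻¹' {w | k w < k (e u)} = {w | k w < k u} :=
    Set.ext fun x => lt_iff_lt_of_le_iff_le (he u x)
  rw [corrIncrement, corrIncrement, condCorr_reindex ν hf hg, condCorr_reindex ν hf hg, hle, hlt]

end Increments

/-! ### Upper bound on covariances along the coordinate axes. -/

section Lattice

variable {n : ℕ}

/-- The ball of radius `R` around `v` in `ℤ^n` for the `ℓ¹`-distance. -/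
noncomputable def l1Ball (R : ℕ) (v : Fin n → ℤ) : Finset (Fin n → ℤ) :=
  {u ∈ Fintype.piFinset fun i => Finset.Icc (v i - R) (v i + R) | ∑ i, |u i - v i| ≤ R}

lemma mem_l1Ball {R : ℕ} {u v : Fin n → ℤ} : u ∈ l1Ball R v ↔ ∑ i, |u i - v i| ≤ R := by
  simp only [l1Ball, Finset.mem_filter, Fintype.mem_piFinset, Finset.mem_Icc,
    and_iff_right_iff_imp]
  intro h i
  have h1 : |u i - v i| ≤ R :=
    (Finset.single_le_sum (f := fun i => |u i - v i|) (fun _ _ => abs_nonneg _)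
      (Finset.mem_univ i)).trans h
  rw [abs_le] at h1
  constructor <;> linarith

lemma sum_abs_sub_le_length {u v : Fin n → ℤ} (p : (latticeGraph n).Walk u v) :
    ∑ i, |v i - u i| ≤ p.length := by
  induction p with
  | nil => simp
  | @cons a b c h p ih =>
    have h1 : ∑ i, |a i - b i| = 1 := h
    have h2 : ∑ i, |c i - a i| ≤ ∑ i, |c i - b i| + ∑ i, |a i - b i| := by
      rw [← Finset.sum_add_distrib]
      refine Finset.sum_le_sum fun i _ => ?_
      rw [abs_sub_comm (a i) (b i)]
      exact abs_sub_le _ _ _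
    rw [SimpleGraph.Walk.length_cons]
    push_cast
    linarith

lemma mem_l1Ball_of_edist_le {R : ℕ} {u v : Fin n → ℤ} (h : (latticeGraph n).edist v u ≤ R) :
    u ∈ l1Ball R v := by
  obtain ⟨p, hp⟩ := SimpleGraph.exists_walk_of_edist_ne_top
    (ne_top_of_le_ne_top (ENat.natCast_ne_top R) h)
  rw [← hp, Nat.cast_le] at h
  rw [mem_l1Ball]
  exact (sum_abs_sub_le_length p).trans (by exact_mod_cast h)

/-- The weight `L + |t|` is chosen so that the sum is 1 at `t = 0`, instead of the 2 given by
constant weights, and grows only linearly in `|t| / L`. -/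
lemma weight_ratio_add_le {L : ℝ} (hL : 0 < L) (t : ℝ) :
    (L + |t|) / (L + |t - L|) + (L + |t|) / (L + |t + L|) ≤ 1 + 2 * |t| / L := by
  wlog ht : 0 ≤ t generalizing t
  · have h := this (-t) (by linarith)
    rw [abs_neg, show -t - L = -(t + L) by ring, show -t + L = -(t - L) by ring, abs_neg,
      abs_neg] at h
    linarith
  rw [abs_of_nonneg ht, abs_of_nonneg (by linarith : 0 ≤ t + L)]
  rcases le_total t L with h | h
  · rw [abs_of_nonpos (by linarith), div_add_div _ _ (by linarith) (by linarith),
      show 1 + 2 * t / L = (L + 2 * t) / L by field_simp, div_le_div_iff₀ (by nlinarith) hL]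
    have h1 : 0 ≤ t * (L - t) := mul_nonneg ht (by linarith)
    nlinarith [mul_nonneg ht (mul_nonneg hL.le hL.le), mul_nonneg h1 hL.le, mul_nonneg h1 ht]
  · have ht' : 0 < t := by linarith
    rw [abs_of_nonneg (by linarith)]
    have h1 : (L + t) / (L + (t - L)) = 1 + L / t := by
      rw [show L + (t - L) = t by ring]
      field_simp
      ring
    have h2 : (L + t) / (L + (t + L)) ≤ 1 := by
      rw [div_le_one (by linarith)]
      linarith
    have h3 : L / t ≤ 1 := by rwa [div_le_one ht']
    have h4 : 1 ≤ t / L := by rwa [one_le_div hL]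
    rw [h1, mul_div_assoc]
    linarith

variable {E : Type*} [MeasurableSpace E] (ν : Measure E) [IsProbabilityMeasure ν]
  {f : (Fin n → ℤ) → ((Fin n → ℤ) → E) → ℝ}

lemma corrIncrement_translate (hf : IsBddMeasurable (f 0))
    (heq : ∀ t v z, f (t + v) z = f v fun u => z (t + u)) (u w : Fin n → ℤ) :
    corrIncrement ν toLex u (f w) (f w) = corrIncrement ν toLex (u - w) (f 0) (f 0) := by
  have h : f w = fun z => f 0 fun i => z (Equiv.addLeft w i) := by
    funext z
    simpa using heq w 0 z
  have h' := corrIncrement_reindex ν toLex hf hf (e := Equiv.addLeft w)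
    (fun x y => add_le_add_iff_left (toLex w)) (u - w)
  rw [← h] at h'
  simpa using h'

lemma two_mul_cov_le {R : ℕ} (hf : ∀ v, IsBddMeasurable (f v))
    (heq : ∀ t v z, f (t + v) z = f v fun u => z (t + u))
    (hdep : ∀ v, DependsOn (f v) (l1Ball R v : Set (Fin n → ℤ))) {L : ℕ} (hL : 0 < L)
    (i : Fin n) :
    2 * (∫ z, f 0 z * f (Pi.single i (L : ℤ)) z ∂iidMeasure _ ν -
        (∫ z, f 0 z ∂iidMeasure _ ν) * ∫ z, f (Pi.single i (L : ℤ)) z ∂iidMeasure _ ν) ≤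
      ∑ x ∈ l1Ball R 0, corrIncrement ν toLex x (f 0) (f 0) * (1 + 2 * |(x i : ℝ)| / L) := by
  classical
  set w : Fin n → ℤ := Pi.single i (L : ℤ) with hw
  have hwi : w i = L := by simp [hw]
  set A := l1Ball R (0 : Fin n → ℤ) ∪ l1Ball R w with hA
  have hL' : (0 : ℝ) < L := by exact_mod_cast hL
  have hinj : Function.Injective (toLex : (Fin n → ℤ) → Lex (Fin n → ℤ)) := toLex.injective
  have hdep0 : DependsOn (f 0) (A : Set (Fin n → ℤ)) :=
    fun _ _ h => hdep 0 fun j hj => h j (by simp [hA, Finset.mem_coe.1 hj])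
  have hdepw : DependsOn (f w) (A : Set (Fin n → ℤ)) :=
    fun _ _ h => hdep w fun j hj => h j (by simp [hA, Finset.mem_coe.1 hj])
  have hpos : ∀ t : ℝ, 0 < L + |t| := fun t => by positivity
  -- Ratio of the weights of `u` as seen from `0` and from `w`. After translating the second sum by
  -- `w`, site `x` carries `c x + (c (x + w))⁻¹`, the left side of `weight_ratio_add_le` at `t = x
  -- i`.
  let c : (Fin n → ℤ) → ℝ := fun u => (L + |(u i : ℝ)|) / (L + |(u i : ℝ) - L|)
  have hc : ∀ u, 0 < c u := fun u => div_pos (hpos _) (hpos _)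
  rw [← sum_corrIncrement ν toLex hinj hdep0 hdepw, Finset.mul_sum]
  refine (Finset.sum_le_sum fun u _ =>
    two_mul_corrIncrement_le ν toLex (hf 0) (hf w) (hc u) u).trans ?_
  have h0 : ∑ u ∈ A, c u * corrIncrement ν toLex u (f 0) (f 0) =
      ∑ u ∈ l1Ball R 0, c u * corrIncrement ν toLex u (f 0) (f 0) :=
    (Finset.sum_subset Finset.subset_union_left fun u _ hu => by
      rw [corrIncrement_self_eq_zero ν toLex hinj (hdep 0) (by simpa using hu), mul_zero]).symm
  have h1 : ∑ u ∈ A, (c u)⁻¹ * corrIncrement ν toLex u (f w) (f w) =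
      ∑ u ∈ l1Ball R w, (c u)⁻¹ * corrIncrement ν toLex u (f w) (f w) :=
    (Finset.sum_subset Finset.subset_union_right fun u _ hu => by
      rw [corrIncrement_self_eq_zero ν toLex hinj (hdep w) (by simpa using hu), mul_zero]).symm
  have h2 : ∑ u ∈ l1Ball R w, (c u)⁻¹ * corrIncrement ν toLex u (f w) (f w) =
      ∑ x ∈ l1Ball R 0, (c (x + w))⁻¹ * corrIncrement ν toLex x (f 0) (f 0) := by
    refine Finset.sum_nbij' (fun u => u - w) (fun x => x + w) ?_ ?_ ?_ ?_ ?_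
    · intro u hu
      rw [mem_l1Ball] at hu ⊢
      simpa using hu
    · intro x hx
      rw [mem_l1Ball] at hx ⊢
      simpa using hx
    · intro u _
      simp
    · intro u _
      simp
    · intro u _
      simp only [sub_add_cancel]
      rw [corrIncrement_translate ν (hf 0) heq]
  rw [Finset.sum_add_distrib, h0, h1, h2, ← Finset.sum_add_distrib]
  refine Finset.sum_le_sum fun x _ => ?_
  have h3 : c x + (c (x + w))⁻¹ ≤ 1 + 2 * |(x i : ℝ)| / L := by
    have := weight_ratio_add_le hL' (x i : ℝ)
    simpa [c, hwi] using this
  rw [← add_mul, mul_comm]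
  exact mul_le_mul_of_nonneg_left h3 (corrIncrement_self_nonneg ν toLex (hf 0) x)

lemma two_mul_sum_cov_le {R : ℕ} (hf : ∀ v, IsBddMeasurable (f v))
    (heq : ∀ t v z, f (t + v) z = f v fun u => z (t + u))
    (hdep : ∀ v, DependsOn (f v) (l1Ball R v : Set (Fin n → ℤ))) {L : ℕ} (hL : 0 < L) :
    2 * ∑ i, (∫ z, f 0 z * f (Pi.single i (L : ℤ)) z ∂iidMeasure _ ν -
        (∫ z, f 0 z ∂iidMeasure _ ν) * ∫ z, f (Pi.single i (L : ℤ)) z ∂iidMeasure _ ν) ≤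
      (n + 2 * R / L) * (∫ z, f 0 z * f 0 z ∂iidMeasure _ ν -
        (∫ z, f 0 z ∂iidMeasure _ ν) * ∫ z, f 0 z ∂iidMeasure _ ν) := by
  have hinj : Function.Injective (toLex : (Fin n → ℤ) → Lex (Fin n → ℤ)) := toLex.injective
  rw [Finset.mul_sum, ← sum_corrIncrement ν toLex hinj (hdep 0) (hdep 0), Finset.mul_sum]
  refine (Finset.sum_le_sum fun i _ => two_mul_cov_le ν hf heq hdep hL i).trans ?_
  rw [Finset.sum_comm]
  refine Finset.sum_le_sum fun x hx => ?_
  rw [← Finset.mul_sum, mul_comm]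
  refine mul_le_mul_of_nonneg_right ?_ (corrIncrement_self_nonneg ν toLex (hf 0) x)
  rw [mem_l1Ball] at hx
  have hx' : ∑ i, |(x i : ℝ)| ≤ R := by
    have : ((∑ i, |x i| : ℤ) : ℝ) ≤ R := by
      simpa using (Int.cast_le (R := ℝ)).2 hx
    simpa using this
  rw [Finset.sum_add_distrib, ← Finset.sum_div, ← Finset.mul_sum]
  simp only [Finset.sum_const, Finset.card_univ, Fintype.card_fin, nsmul_eq_mul, mul_one]
  gcongr

end Lattice

/-! ### Lower bound on covariances from near-alternation, and comparison of the two bounds. -/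

section IndependentSet

variable {n : ℕ} {E : Type*} [MeasurableSpace E] (ν : Measure E) [IsProbabilityMeasure ν]
  {f : (Fin n → ℤ) → ((Fin n → ℤ) → E) → ℝ}

lemma integral_translate (hf : IsBddMeasurable (f 0))
    (heq : ∀ t v z, f (t + v) z = f v fun u => z (t + u)) (v : Fin n → ℤ) :
    ∫ z, f v z ∂iidMeasure _ ν = ∫ z, f 0 z ∂iidMeasure _ ν := by
  have h := measurePreserving_reindex (E := E) ν (Equiv.addLeft v)
  conv_rhs => rw [← h.map_eq]
  rw [integral_map h.measurable.aemeasurable hf.measurable.aestronglyMeasurable]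
  refine integral_congr_ae (Filter.Eventually.of_forall fun z => ?_)
  simpa using heq v 0 z

lemma integral_abs_defect (hf : ∀ v, IsBddMeasurable (f v))
    (heq : ∀ t v z, f (t + v) z = f v fun u => z (t + u))
    (hadj : ∀ u v, (latticeGraph n).Adj u v → ∀ᵐ z ∂iidMeasure _ ν, f u z + f v z ≤ 1)
    {u v : Fin n → ℤ} (huv : (latticeGraph n).Adj u v) :
    ∫ z, |1 - f u z - f v z| ∂iidMeasure _ ν = 1 - 2 * ∫ z, f 0 z ∂iidMeasure _ ν := by
  have h : ∀ᵐ z ∂iidMeasure _ ν, |1 - f u z - f v z| = 1 - f u z - f v z := by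
    filter_upwards [hadj u v huv] with z hz
    exact abs_of_nonneg (by linarith)
  rw [integral_congr_ae h, ((IsBddMeasurable.const 1).sub (hf u)).integral_sub (hf v),
    (IsBddMeasurable.const 1).integral_sub (hf u),
    integral_translate ν (hf 0) heq u, integral_translate ν (hf 0) heq v]
  simp
  ring

lemma latticeGraph_adj_single (i : Fin n) (k : ℤ) :
    (latticeGraph n).Adj (Pi.single i k) (Pi.single i (k + 1)) := by
  change ∑ j, |(Pi.single i k : Fin n → ℤ) j - (Pi.single i (k + 1) : Fin n → ℤ) j| = 1
  rw [Finset.sum_eq_single i]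
  · simp
  · intro j _ hj
    simp [hj]
  · simp

/-- Along a path each edge flips the value up to an error of mean `1 - 2p`; an even number of flips
cancels, and the errors add by the triangle inequality. -/
lemma integral_abs_sub_even_shift_le (hf : ∀ v, IsBddMeasurable (f v))
    (heq : ∀ t v z, f (t + v) z = f v fun u => z (t + u))
    (hadj : ∀ u v, (latticeGraph n).Adj u v → ∀ᵐ z ∂iidMeasure _ ν, f u z + f v z ≤ 1)
    (i : Fin n) (m : ℕ) :
    ∫ z, |f 0 z - f (Pi.single i ((2 * m : ℕ) : ℤ)) z| ∂iidMeasure _ ν ≤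
      2 * m * (1 - 2 * ∫ z, f 0 z ∂iidMeasure _ ν) := by
  induction m with
  | zero => simp
  | succ m ih =>
    set a : ℤ := ((2 * m : ℕ) : ℤ) with ha
    have hb : ((2 * (m + 1) : ℕ) : ℤ) = a + 1 + 1 := by
      rw [ha]
      push_cast
      ring
    rw [hb]
    have h1 := integral_abs_defect ν hf heq hadj (latticeGraph_adj_single i a)
    have h2 := integral_abs_defect ν hf heq hadj (latticeGraph_adj_single i (a + 1))
    set u : Fin n → ℤ := Pi.single i a
    set v : Fin n → ℤ := Pi.single i (a + 1)
    set w : Fin n → ℤ := Pi.single i (a + 1 + 1)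
    have i0 := ((hf 0).sub (hf u)).abs
    have i1 := (((IsBddMeasurable.const (α := (Fin n → ℤ) → E) 1).sub (hf u)).sub (hf v)).abs
    have i2 := (((IsBddMeasurable.const (α := (Fin n → ℤ) → E) 1).sub (hf v)).sub (hf w)).abs
    have h3 : ∫ z, |f 0 z - f w z| ∂iidMeasure _ ν ≤
        ∫ z, (|f 0 z - f u z| + |1 - f u z - f v z| + |1 - f v z - f w z|) ∂iidMeasure _ ν := by
      refine integral_mono (((hf 0).sub (hf w)).abs.integrable _) (((i0.add i1).add i2).integrable _) fun z => ?_
      have e : f 0 z - f w z =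
          (f 0 z - f u z) - (1 - f u z - f v z) + (1 - f v z - f w z) := by ring
      simp only [e]
      exact (abs_add_le _ _).trans (by gcongr; exact abs_sub _ _)
    rw [(i0.add i1).integral_add i2, i0.integral_add i1, h1, h2] at h3
    push_cast
    linarith

/-- A translation-equivariant random independent set whose indicator `f` has radius `R` has
density bounded away from `1 / 2`. -/
lemma density_sub_sq_le {R : ℕ} (hf : ∀ v, IsBddMeasurable (f v))
    (h01 : ∀ v z, f v z * f v z = f v z)
    (heq : ∀ t v z, f (t + v) z = f v fun u => z (t + u))
    (hdep : ∀ v, DependsOn (f v) (l1Ball R v : Set (Fin n → ℤ)))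
    (hadj : ∀ u v, (latticeGraph n).Adj u v → ∀ᵐ z ∂iidMeasure _ ν, f u z + f v z ≤ 1)
    (hn : 0 < n) {m : ℕ} (hm : 0 < m) (hmR : 2 * R ≤ n * m) {p : ℝ}
    (hp : ∫ z, f 0 z ∂iidMeasure _ ν = p) : p - p ^ 2 ≤ 4 * m * (1 - 2 * p) := by
  have hpp : 0 ≤ p - p ^ 2 := by
    have := (hf 0).sq_integral_le (iidMeasure _ ν)
    simp only [h01, hp] at this
    linarith
  have hcov : ∀ i : Fin n, p - p ^ 2 - m * (1 - 2 * p) ≤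
      ∫ z, f 0 z * f (Pi.single i ((2 * m : ℕ) : ℤ)) z ∂iidMeasure _ ν -
        (∫ z, f 0 z ∂iidMeasure _ ν) *
          ∫ z, f (Pi.single i ((2 * m : ℕ) : ℤ)) z ∂iidMeasure _ ν := by
    intro i
    have h := integral_abs_sub_even_shift_le ν hf heq hadj i m
    set w : Fin n → ℤ := Pi.single i ((2 * m : ℕ) : ℤ)
    -- For values in `{0, 1}` the mean distance determines the mean product.
    have e : ∀ z, |f 0 z - f w z| = f 0 z + f w z - 2 * (f 0 z * f w z) := by
      intro z
      have h (v) : f v z = 0 ∨ f v z = 1 := by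
        have : f v z * (f v z - 1) = 0 := by rw [mul_sub, h01, mul_one, sub_self]
        exact (mul_eq_zero.1 this).imp_right sub_eq_zero.1
      rcases h 0 with h0 | h0 <;> rcases h w with h1 | h1 <;> norm_num [h0, h1]
    simp only [e] at h
    rw [((hf 0).add (hf w)).integral_sub (((hf 0).mul (hf w)).const_mul 2),
      (hf 0).integral_add (hf w), integral_const_mul] at h
    rw [integral_translate ν (hf 0) heq w, hp] at h ⊢
    linarith
  have hsum := two_mul_sum_cov_le ν hf heq hdep (L := 2 * m) (by omega)
  have hlow := Finset.sum_le_sum fun i (_ : i ∈ Finset.univ) => hcov i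
  simp only [Finset.sum_const, Finset.card_univ, Fintype.card_fin, nsmul_eq_mul] at hlow
  simp only [h01, hp] at hsum hlow
  have hn' : (0 : ℝ) < n := by exact_mod_cast hn
  have hm' : (0 : ℝ) < m := by exact_mod_cast hm
  have hratio : 2 * (R : ℝ) / ((2 * m : ℕ) : ℝ) ≤ n / 2 := by
    have : 2 * (R : ℝ) ≤ n * m := by exact_mod_cast hmR
    rw [div_le_iff₀ (by positivity)]
    push_cast
    linarith
  -- The factor on the right is below `2 * n`, so a positive share of the variance survives and must
  -- be paid for by the defect.
  have h5 : 2 * (n * (p - p ^ 2 - m * (1 - 2 * p))) ≤ (n + n / 2) * (p - p * p) := by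
    refine (mul_le_mul_of_nonneg_left hlow zero_le_two).trans (hsum.trans ?_)
    refine mul_le_mul_of_nonneg_right (by linarith) (by nlinarith)
  have h6 : 0 ≤ n * (4 * m * (1 - 2 * p) - (p - p ^ 2)) := by nlinarith
  linarith [nonneg_of_mul_nonneg_right h6 hn']

end IndependentSet

/-! ### Choice of the shift and conclusion. -/

lemma half_sub_ge_of_sub_sq_le {n R : ℕ} {p : ℝ} (hn : 1 ≤ n) (hR : 3 * (n : ℝ) < R)
    (hp : p ≤ 1 / 2)
    (h : ∀ m : ℕ, 0 < m → 2 * R ≤ n * m → p - p ^ 2 ≤ 4 * m * (1 - 2 * p)) :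
    p ≤ 1 / 2 - 1 / 128 * n / (R * Real.log (R / n)) := by
  have hn' : (0 : ℝ) < n := by exact_mod_cast hn
  have hR' : (0 : ℝ) < R := by linarith
  have hq : 3 < (R : ℝ) / n := by rwa [lt_div_iff₀ hn']
  -- The constant 3 exceeds `e`, so the logarithm is at least 1 and can be dropped.
  have hlog : 1 ≤ Real.log (R / n) := by
    rw [Real.le_log_iff_exp_le (by linarith)]
    linarith [Real.exp_one_lt_d9]
  have hb : 1 / 128 * n / (R * Real.log (R / n)) ≤ 1 / 128 * n / R :=
    div_le_div_of_nonneg_left (by positivity) hR' (by nlinarith)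
  have hs : 1 / 128 * (n : ℝ) / R ≤ 1 / 384 := by
    rw [div_le_iff₀ hR']
    linarith
  -- Small densities are trivial, as the subtracted term is at most `1 / 384`. For `p` in `[1 / 4, 1
  -- / 2]` the variance is at least `3 / 16`.
  rcases lt_or_ge p (1 / 4) with hlt | hge
  · linarith
  set q : ℝ := (R : ℝ) / n with hqd
  have hm1 := Nat.le_ceil (2 * q)
  have hm2 := Nat.ceil_lt_add_one (show 0 ≤ 2 * q by linarith)
  set m := ⌈2 * q⌉₊
  have hm0 : (0 : ℝ) < m := by linarith
  have hRq : (R : ℝ) = n * q := by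
    rw [hqd]
    field_simp
  have hmR : 2 * R ≤ n * m := by
    have : 2 * (R : ℝ) ≤ n * m := by nlinarith
    exact_mod_cast this
  have h1 := h m (by exact_mod_cast hm0) hmR
  have h2 : 3 / 16 ≤ p - p ^ 2 := by nlinarith
  -- Since `m < 2 * q + 1 ≤ 3 * q`. Then `3 / 16 ≤ 12 * q * (1 - 2 * p)`, which is where `1 / 128`
  -- comes from.
  have h3 : 4 * (m : ℝ) * (1 - 2 * p) ≤ 4 * (3 * q) * (1 - 2 * p) :=
    mul_le_mul_of_nonneg_right (by linarith) (by linarith)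
  have h4 : 1 / 128 * (n : ℝ) / R ≤ 1 / 2 - p := by
    rw [div_le_iff₀ hR', hRq]
    nlinarith
  linarith

theorem theorem5 :
    ∃ c C : ℝ, 0 < c ∧ 1 ≤ C ∧
      ∀ (n R : ℕ), 1 ≤ n → C * n < R →
        ∀ (Γ : Subgroup (latticeGraph n ≃g latticeGraph n)),
          (∀ t : Fin n → ℤ, latticeTranslation t ∈ Γ) →
        ∀ {Ω : Type*} [MeasurableSpace Ω] (P : Measure Ω) [IsProbabilityMeasure P]
          (X : (Fin n → ℤ) → Ω → Fin 2),
          IsFactorOfIID (latticeGraph n) Γ R P X →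
          DefinesIndepSet (latticeGraph n) P X →
          ∀ v : Fin n → ℤ,
            P.real {ω | X v ω = 1} ≤ 1 / 2 - c * n / (R * Real.log (R / n)) := by
  refine ⟨1 / 128, 3, by norm_num, by norm_num, ?_⟩
  intro n R hn hR Γ hΓ Ω _ P _ X hX hind v
  obtain ⟨Z, F, hZm, hZi, hZu, hF, hequiv, hloc, hXF⟩ := hX
  have hlaw : P.map (fun ω u => Z u ω) =
      iidMeasure (Fin n → ℤ) (volume : Measure unitInterval) := by
    rw [hZi.map_fun_eq_infinitePi_map hZm]
    simp only [hZu]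
  have hZ : Measurable fun ω u => Z u ω := measurable_pi_lambda _ hZm
  let f : (Fin n → ℤ) → ((Fin n → ℤ) → unitInterval) → ℝ := fun v z => if F z v = 1 then 1 else 0
  have hset : ∀ v, MeasurableSet {z | F z v = 1} := fun v =>
    ((measurable_pi_apply v).comp hF) (measurableSet_singleton 1)
  have hf : ∀ v, IsBddMeasurable (f v) := fun v =>
    ⟨Measurable.ite (hset v) measurable_const measurable_const, 1, fun z => by
      by_cases h : F z v = 1 <;> simp [f, h]⟩
  have h01 : ∀ v z, f v z * f v z = f v z := fun v z => by simp [f]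
  have heq : ∀ t v z, f (t + v) z = f v fun u => z (t + u) := fun t v z => by
    have : F (fun u => z (t + u)) v = F z (t + v) := congrFun (hequiv _ (hΓ t) z) v
    simp only [f, this]
  have hdep : ∀ v, DependsOn (f v) (l1Ball R v : Set (Fin n → ℤ)) := fun v z z' h => by
    have := hloc v z z' fun u hu => h u (mem_l1Ball_of_edist_le hu)
    simp only [f, this]
  have hadj : ∀ u v, (latticeGraph n).Adj u v →
      ∀ᵐ z ∂iidMeasure _ (volume : Measure unitInterval), f u z + f v z ≤ 1 := by
    intro u v huv
    rw [← hlaw, ae_map_iff hZ.aemeasurable (measurableSet_le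
      ((hf u).add (hf v)).measurable measurable_const)]
    filter_upwards [hind u v huv, hXF u, hXF v] with ω h hu hv
    rw [hu, hv] at h
    by_cases h1 : F (fun u => Z u ω) u = 1 <;> by_cases h2 : F (fun u => Z u ω) v = 1 <;>
      simp_all [f]
  have hmean : ∫ z, f v z ∂iidMeasure _ (volume : Measure unitInterval) =
      P.real {ω | X v ω = 1} := by
    have h1 : P.real {ω | X v ω = 1} = P.real {ω | F (fun u => Z u ω) v = 1} := by
      refine measureReal_congr ?_
      filter_upwards [hXF v] with ω h
      change (X v ω = 1) = (F (fun u => Z u ω) v = 1)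
      rw [h]
    have h2 : ∀ z, f v z = Set.indicator {z | F z v = 1} 1 z := fun z => by
      simp [f, Set.indicator_apply]
    simp only [h2]
    rw [integral_indicator_one (hset v), ← hlaw, map_measureReal_apply hZ (hset v), h1]
    rfl
  rw [integral_translate _ (hf 0) heq v] at hmean
  refine half_sub_ge_of_sub_sq_le hn hR ?_ fun m hm hmR =>
    density_sub_sq_le volume hf h01 heq hdep hadj hn hm hmR hmean
  -- The defect of any edge has nonnegative mean, hence `p ≤ 1 / 2`; `1 ≤ n` supplies an edge.
  have h := integral_abs_defect volume hf heq hadj (latticeGraph_adj_single ⟨0, hn⟩ 0)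
  have h' : 0 ≤ ∫ z, |1 - f (Pi.single ⟨0, hn⟩ 0) z - f (Pi.single ⟨0, hn⟩ (0 + 1)) z|
      ∂iidMeasure _ (volume : Measure unitInterval) := integral_nonneg fun z => abs_nonneg _
  rw [h, hmean] at h'
  linarith
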